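/- There is a universal constant $C>0$ with the following property. Let $n\ge 2$, $m\ge 1$ and $d_1,\dots,d_m\ge 1$ be integers, let $d:=\max_i d_i$, and let $P=(p_1,\dots,p_m)$ be the random system of homogeneous polynomials $$p_j(x)=\sum_{|a|=d_j} c_{j,a}\sqrt{\binom{d_j}{a}}\,x^a,\qquad x\in\mathbb{R}^n,\quad \binom{d_j}{a}:=\frac{d_j!}{a_1!\cdots a_n!},$$ where the coefficient vectors $C_j=(c_{j,a})_{|a|=d_j}\in\mathbb{R}^{N_j}$, $N_j=\binom{n+d_j-1}{d_j}$, are independent random vectors satisfying the Small Ball assumption with constant $c_0>0$: for all $j$, all nonzero $v\in\mathbb{R}^{N_j}$ and all $\varepsilon>0$, $$\mathrm{Prob}\left(|\langle v,C_j\rangle|\le\varepsilon\|v\|_2\right)\le c_0\,\varepsilon .$$ Let $\alpha,\gamma>0$ satisfy $\alpha\le\gamma\min\{d^{-6},\,d^2/n\}$. Then $$\mathrm{Prob}\left(L(P)\le\alpha\right)\le\mathrm{Prob}\left(\|P\|_\infty\ge\gamma\right)+\alpha^{\frac32+m-n}\,\sqrt{n}\,\left(\gamma d^2\right)^{n-\frac32}\left(\frac{C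 c_0}{\sqrt{m}}\right)^{m}.$$ Here $\|P\|_\infty:=\sup_{x\in S^{n-1}}\|P(x)\|_2$ and $$L(P):=\min_{\substack{x,y\in S^{n-1}\\ x\perp y}}\sqrt{\|\Delta^{-1}DP(x)y\|_2^2+\|P(x)\|_2^2},$$ where $DP(x)$ is the $m\times n$ Jacobian matrix of $P$ at $x$ and $\Delta$ is the $m\times m$ diagonal matrix with diagonal entries $\sqrt{d_1},\dots,\sqrt{d_m}$. -/

import Mathlib

noncomputable section

/-- Exponent vectors `a = (a₁, …, aₙ)` of natural numbers with `a₁ + ⋯ + aₙ = d`; there are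
`(n + d - 1).choose d` of them. -/
abbrev ExponentIndex (n d : ℕ) : Type :=
  ↥(Finset.piAntidiag (Finset.univ : Finset (Fin n)) d)

/-- The form `∑_{|a| = d} c_a √(d! / (a₁! ⋯ aₙ!)) x^a` with coefficient vector `c`. -/
def weylForm {n d : ℕ} (c : EuclideanSpace ℝ (ExponentIndex n d)) : MvPolynomial (Fin n) ℝ :=
  ∑ a : ExponentIndex n d,
    MvPolynomial.monomial (Finsupp.equivFunOnFinite.symm a.1)
      (c a * √(Nat.multinomial Finset.univ a.1 : ℝ))

/-- The value `P(x) ∈ ℝᵐ` of a polynomial system at a point `x ∈ ℝⁿ`. -/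
def evalSystem {n m : ℕ} (P : Fin m → MvPolynomial (Fin n) ℝ)
    (x : EuclideanSpace ℝ (Fin n)) : EuclideanSpace ℝ (Fin m) :=
  WithLp.toLp 2 fun i => MvPolynomial.eval (fun k => x k) (P i)

/-- The vector `DP(x) y ∈ ℝᵐ`: the Jacobian matrix of the system at `x`, applied to `y`. -/
def jacobianApply {n m : ℕ} (P : Fin m → MvPolynomial (Fin n) ℝ)
    (x y : EuclideanSpace ℝ (Fin n)) : EuclideanSpace ℝ (Fin m) :=
  WithLp.toLp 2 fun i =>
    ∑ k : Fin n, MvPolynomial.eval (fun l => x l) (MvPolynomial.pderiv k (P i)) * y k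

/-- The vector `Δ⁻¹ v`, where `Δ` is the diagonal matrix with entries `√d₁, …, √dₘ`. -/
def degreeScale {m : ℕ} (d : Fin m → ℕ) (v : EuclideanSpace ℝ (Fin m)) :
    EuclideanSpace ℝ (Fin m) :=
  WithLp.toLp 2 fun i => (√(d i : ℝ))⁻¹ * v i

/-- `√(‖Δ⁻¹ DP(x) y‖² + ‖P(x)‖²)`. -/
def scriptL {n m : ℕ} (d : Fin m → ℕ) (P : Fin m → MvPolynomial (Fin n) ℝ)
    (x y : EuclideanSpace ℝ (Fin n)) : ℝ :=
  √(‖degreeScale d (jacobianApply P x y)‖ ^ 2 + ‖evalSystem P x‖ ^ 2)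

/-- The pairs of mutually orthogonal points of the unit sphere of `ℝⁿ`. -/
def OrthoPair (n : ℕ) : Type :=
  {q : EuclideanSpace ℝ (Fin n) × EuclideanSpace ℝ (Fin n) //
    ‖q.1‖ = 1 ∧ ‖q.2‖ = 1 ∧ inner ℝ q.1 q.2 = 0}

/-- `L(P)`, the minimum of `scriptL d P x y` over orthogonal unit vectors `x`, `y`. For `2 ≤ n` the
set of these pairs is compact and non-empty, so that the infimum is a minimum. -/
def systemL {n m : ℕ} (d : Fin m → ℕ) (P : Fin m → MvPolynomial (Fin n) ℝ) : ℝ :=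
  ⨅ q : OrthoPair n, scriptL d P q.1.1 q.1.2

/-- `‖P‖_∞`, the supremum over the unit sphere of the Euclidean norm of `P(x)`. -/
def systemSupNorm {n m : ℕ} (P : Fin m → MvPolynomial (Fin n) ℝ) : ℝ :=
  ⨆ x : Metric.sphere (0 : EuclideanSpace ℝ (Fin n)) 1, ‖evalSystem P x.1‖

/-- The Small Ball assumption with constant `c₀` for a random vector `X`. The vector `a` has to be
nonzero: for `a = 0` the event has probability one. -/
def SmallBall {Ω ι : Type*} [MeasurableSpace Ω] [Fintype ι] (μ : MeasureTheory.Measure Ω)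
    (X : Ω → EuclideanSpace ℝ ι) (c₀ : ℝ) : Prop :=
  ∀ a : EuclideanSpace ℝ ι, a ≠ 0 → ∀ ε : ℝ, 0 < ε →
    μ.real {ω | |inner ℝ a (X ω)| ≤ ε * ‖a‖} ≤ c₀ * ε

end

/-!
Suppose `‖P‖_∞ < γ` while `L(P) ≤ α` is nearly attained at the orthonormal pair `x`, `y`. Along a
great circle, `P` is an entire function of exponential type at most `D`, bounded by `γ` on the real
line, so Phragmén–Lindelöf and Cauchy's estimates (Bernstein's inequality) bound its derivatives by
multiples of `γ D` and `γ D²`. Since `P(x)` and the derivative of `P` at `x` in the direction `y`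
are small, the radial extension of `P` is `O(α)` on a whole patch around `x`, of width `β` in the
direction `y` and `β²` in the remaining `n - 2` directions, where `β² ≍ α / (γ D²)`. The patch fills
a proportion `≍ β^(2n - 3)` of a ball, up to a factor exponential in `n`, and the choice of the
constant in `β` absorbs that factor.

At a fixed unit vector, independence and the Small Ball assumption make the event `‖P‖ = O(α)` have
probability at most `(C c₀ α / √m)^m`. By Fubini's theorem and Markov's inequality, the set where
`‖P‖ = O(α)` is therefore unlikely to be as large as the patch.
-/

section ExponentialType

theorem norm_image_sub_le_of_norm_deriv_deriv_le {E : Type*} [NormedAddCommGroup E]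
    [NormedSpace ℝ E] {f f' f'' : ℝ → E} {B : ℝ} (hf : ∀ s, HasDerivAt f (f' s) s)
    (hf' : ∀ s, HasDerivAt f' (f'' s) s) (hB : ∀ s, ‖f'' s‖ ≤ B) (a b : ℝ) :
    ‖f b - f a‖ ≤ ‖f' a‖ * |b - a| + B * (b - a) ^ 2 := by
  have hB0 : 0 ≤ B := (norm_nonneg _).trans (hB 0)
  have norm_f'_le : ∀ s ∈ Set.uIcc a b, ‖f' s‖ ≤ ‖f' a‖ + B * |b - a| := by
    intro s hs
    have hs' : ‖f' s - f' a‖ ≤ B * |s - a| :=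
      convex_univ.norm_image_sub_le_of_norm_hasDerivWithin_le
        (fun u _ => (hf' u).hasDerivWithinAt) (fun u _ => hB u) trivial trivial
    calc ‖f' s‖ ≤ ‖f' a‖ + ‖f' s - f' a‖ := norm_le_norm_add_norm_sub' _ _
      _ ≤ ‖f' a‖ + B * |b - a| := by
          gcongr ‖f' a‖ + ?_
          exact hs'.trans (by gcongr ?_ * ?_; exact Set.abs_sub_left_of_mem_uIcc hs)
  calc ‖f b - f a‖ ≤ (‖f' a‖ + B * |b - a|) * ‖b - a‖ :=
        (convex_uIcc a b).norm_image_sub_le_of_norm_hasDerivWithin_le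
          (fun s _ => (hf s).hasDerivWithinAt) norm_f'_le Set.left_mem_uIcc Set.right_mem_uIcc
    _ = ‖f' a‖ * |b - a| + B * (b - a) ^ 2 := by
        rw [Real.norm_eq_abs, ← sq_abs (b - a)]
        ring

variable {E : Type*} [NormedAddCommGroup E] [NormedSpace ℂ E] {f : ℂ → E} {K σ M : ℝ}

theorem norm_le_mul_exp_im_of_im_nonneg (hf : Differentiable ℂ f)
    (hK : ∀ z : ℂ, ‖f z‖ ≤ K * Real.exp (σ * |z.im|)) (hM : ∀ x : ℝ, ‖f x‖ ≤ M) {z : ℂ}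
    (hz : 0 ≤ z.im) : ‖f z‖ ≤ M * Real.exp (σ * z.im) := by
  -- Multiplying by `exp (I * σ * z)` cancels the growth in the upper half plane, which is turned
  -- into the right half plane so that the Phragmén–Lindelöf principle applies.
  set g : ℂ → E := fun w => Complex.exp (-σ * w) • f (Complex.I * w) with hg
  have differentiable_g : Differentiable ℂ g := by fun_prop
  have norm_g (w : ℂ) : ‖g w‖ = Real.exp (-(σ * w.re)) * ‖f (Complex.I * w)‖ := by
    simp [hg, norm_smul, Complex.norm_exp]
  have norm_g_le {w : ℂ} (hw : 0 ≤ w.re) : ‖g w‖ ≤ K := by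
    have hKw : ‖f (Complex.I * w)‖ ≤ K * Real.exp (σ * w.re) := by
      simpa [abs_of_nonneg hw] using hK (Complex.I * w)
    calc ‖g w‖ ≤ Real.exp (-(σ * w.re)) * (K * Real.exp (σ * w.re)) := by rw [norm_g]; gcongr
      _ = K := by rw [mul_left_comm, ← Real.exp_add]; simp
  have norm_g_imaginary_le (x : ℝ) : ‖g (x * Complex.I)‖ ≤ M := by
    have rotate : Complex.I * ((x : ℂ) * Complex.I) = ((-x : ℝ) : ℂ) := by
      push_cast
      linear_combination (x : ℂ) * Complex.I_mul_I
    rw [norm_g, rotate]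
    simpa using hM (-x)
  have norm_g_le_M : ‖g (-Complex.I * z)‖ ≤ M := by
    refine PhragmenLindelof.right_half_plane_of_bounded_on_real differentiable_g.diffContOnCl
      ⟨0, by norm_num, 0, Asymptotics.IsBigO.of_bound K ?_⟩
      (Filter.isBoundedUnder_of_eventually_le (a := K) ?_) norm_g_imaginary_le (by simpa using hz)
    · refine Filter.eventually_inf_principal.2 (Filter.Eventually.of_forall fun w hw => ?_)
      simpa using norm_g_le (le_of_lt hw)
    · filter_upwards [Filter.eventually_ge_atTop 0] with x hx
      exact norm_g_le (by simpa using hx)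
  have unrotate : Complex.I * (-Complex.I * z) = z := by
    linear_combination (-z) * Complex.I_mul_I
  rw [norm_g, unrotate, show (-Complex.I * z).re = z.im by simp] at norm_g_le_M
  calc ‖f z‖ = (Real.exp (-(σ * z.im)) * ‖f z‖) * Real.exp (σ * z.im) := by
        rw [mul_right_comm, ← Real.exp_add]; simp
    _ ≤ M * Real.exp (σ * z.im) := by gcongr

theorem norm_le_mul_exp_abs_im (hf : Differentiable ℂ f)
    (hK : ∀ z : ℂ, ‖f z‖ ≤ K * Real.exp (σ * |z.im|)) (hM : ∀ x : ℝ, ‖f x‖ ≤ M) (z : ℂ) :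
    ‖f z‖ ≤ M * Real.exp (σ * |z.im|) := by
  rcases le_total 0 z.im with hz | hz
  · rw [abs_of_nonneg hz]
    exact norm_le_mul_exp_im_of_im_nonneg hf hK hM hz
  · rw [abs_of_nonpos hz]
    simpa using norm_le_mul_exp_im_of_im_nonneg (f := fun w => f (-w)) (hf.comp differentiable_neg)
      (fun w => by simpa using hK (-w)) (fun x => by simpa using hM (-x)) (z := -z)
      (by simpa using hz)

-- Bernstein's inequality, up to a constant: Cauchy's estimate on circles of radius `σ⁻¹`.
theorem norm_iteratedDeriv_ofReal_le [CompleteSpace E] (hf : Differentiable ℂ f) (hσ : 0 < σ)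
    (hK : ∀ z : ℂ, ‖f z‖ ≤ K * Real.exp (σ * |z.im|)) (hM : ∀ x : ℝ, ‖f x‖ ≤ M) (k : ℕ) (x : ℝ) :
    ‖iteratedDeriv k f x‖ ≤ k.factorial * σ ^ k * (Real.exp 1 * M) := by
  have hM0 : 0 ≤ M := (norm_nonneg _).trans (hM 0)
  have norm_f_le : ∀ w ∈ Metric.sphere (x : ℂ) σ⁻¹, ‖f w‖ ≤ Real.exp 1 * M := by
    intro w hw
    have abs_im_le : |w.im| ≤ σ⁻¹ := by
      simpa [mem_sphere_iff_norm.1 hw] using Complex.abs_im_le_norm (w - x)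
    have : σ * |w.im| ≤ 1 := (mul_le_mul_of_nonneg_left abs_im_le hσ.le).trans_eq
      (mul_inv_cancel₀ hσ.ne')
    calc ‖f w‖ ≤ M * Real.exp (σ * |w.im|) := norm_le_mul_exp_abs_im hf hK hM w
      _ ≤ M * Real.exp 1 := by gcongr
      _ = Real.exp 1 * M := mul_comm _ _
  calc ‖iteratedDeriv k f x‖ ≤ k.factorial * (Real.exp 1 * M) / σ⁻¹ ^ k :=
        Complex.norm_iteratedDeriv_le_of_forall_mem_sphere_norm_le k (inv_pos.2 hσ)
          hf.diffContOnCl norm_f_le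
    _ = k.factorial * σ ^ k * (Real.exp 1 * M) := by rw [inv_pow, div_inv_eq_mul]; ring

theorem hasDerivAt_comp_ofReal {f' : E} {s : ℝ} (hf : HasDerivAt f f' s) :
    HasDerivAt (fun t : ℝ => f t) f' s := by
  simpa using! hf.scomp s Complex.ofRealCLM.hasDerivAt

theorem norm_ofReal_sub_le [CompleteSpace E] (hf : Differentiable ℂ f) (hσ : 0 < σ)
    (hK : ∀ z : ℂ, ‖f z‖ ≤ K * Real.exp (σ * |z.im|)) (hM : ∀ x : ℝ, ‖f x‖ ≤ M) (a b : ℝ) :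
    ‖f b - f a‖ ≤ σ * (Real.exp 1 * M) * |b - a| :=
  convex_univ.norm_image_sub_le_of_norm_hasDerivWithin_le (f := fun s : ℝ => f s)
    (f' := fun s => deriv f s)
    (fun s _ => (hasDerivAt_comp_ofReal (hf s).hasDerivAt).hasDerivWithinAt)
    (fun s _ => by simpa using norm_iteratedDeriv_ofReal_le hf hσ hK hM 1 s) trivial trivial

theorem norm_ofReal_sub_le_deriv [CompleteSpace E] (hf : Differentiable ℂ f) (hσ : 0 < σ)
    (hK : ∀ z : ℂ, ‖f z‖ ≤ K * Real.exp (σ * |z.im|)) (hM : ∀ x : ℝ, ‖f x‖ ≤ M) (a b : ℝ) :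
    ‖f b - f a‖ ≤ ‖deriv f a‖ * |b - a| + 2 * σ ^ 2 * (Real.exp 1 * M) * (b - a) ^ 2 := by
  have hf' : Differentiable ℂ (deriv f) := (hf.contDiff (n := 2)).differentiable_deriv_two
  refine norm_image_sub_le_of_norm_deriv_deriv_le (f := fun s : ℝ => f s)
    (fun s => hasDerivAt_comp_ofReal (hf s).hasDerivAt)
    (fun s => hasDerivAt_comp_ofReal (hf' s).hasDerivAt) (fun s => ?_) a b
  simpa [iteratedDeriv_succ] using norm_iteratedDeriv_ofReal_le hf hσ hK hM 2 s

end ExponentialType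

section Polynomials

open MvPolynomial

variable {σ : Type*}

theorem aeval_ofReal (p : MvPolynomial σ ℝ) (x : σ → ℝ) :
    aeval (fun k => (x k : ℂ)) p = (eval x p : ℂ) := by
  simpa [aeval_eq_eval, Function.comp_def] using aeval_algebraMap_apply (A := ℝ) ℂ x p

theorem hasDerivAt_aeval [Fintype σ] (p : MvPolynomial σ ℝ) {g : ℂ → σ → ℂ} {g' : σ → ℂ}
    {z : ℂ} (hg : ∀ k, HasDerivAt (fun w => g w k) (g' k) z) :
    HasDerivAt (fun w => aeval (g w) p) (∑ k, aeval (g z) (pderiv k p) * g' k) z := by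
  classical
  induction p using MvPolynomial.induction_on with
  | C a => simpa using hasDerivAt_const z (a : ℂ)
  | add p q hp hq =>
    simp only [map_add, add_mul, Finset.sum_add_distrib]
    exact hp.add hq
  | mul_X p i hp =>
    simp only [map_mul, aeval_X]
    refine (hp.mul (hg i)).congr_deriv ?_
    have sum_pderiv_X : ∑ k, aeval (g z) (pderiv k (X i : MvPolynomial σ ℝ)) * g' k = g' i := by
      simp [pderiv_X, Pi.single_apply, apply_ite, ite_mul]
    simp only [Derivation.leibniz, smul_eq_mul, map_add, map_mul, add_mul, mul_assoc,
      Finset.sum_add_distrib, ← Finset.mul_sum, sum_pderiv_X, aeval_X]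
    rw [add_comm, Finset.sum_mul, Finset.mul_sum]
    exact congrArg _ (Finset.sum_congr rfl fun k _ => by ring)

theorem norm_aeval_le_pow {p : MvPolynomial σ ℝ} {D : ℕ} (hp : p.totalDegree ≤ D) {g : σ → ℂ}
    {B : ℝ} (hB : 1 ≤ B) (hg : ∀ k, ‖g k‖ ≤ B) :
    ‖aeval g p‖ ≤ (∑ s ∈ p.support, |p.coeff s|) * B ^ D := by
  rw [aeval_def, eval₂_eq, Finset.sum_mul]
  refine (norm_sum_le _ _).trans (Finset.sum_le_sum fun s hs => ?_)
  rw [norm_mul, norm_prod, norm_algebraMap', Real.norm_eq_abs]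
  gcongr
  calc ∏ k ∈ s.support, ‖g k ^ s k‖ ≤ ∏ k ∈ s.support, B ^ s k := by
        gcongr with k
        rw [norm_pow]
        gcongr
        exact hg k
    _ = B ^ ∑ k ∈ s.support, s k := Finset.prod_pow_eq_pow_sum _ _ _
    _ ≤ B ^ D := pow_le_pow_right₀ hB ((le_totalDegree hs).trans hp)

end Polynomials

section SupNorm

variable {n m : ℕ} {P : Fin m → MvPolynomial (Fin n) ℝ}

theorem continuous_evalSystem (P : Fin m → MvPolynomial (Fin n) ℝ) :
    Continuous (evalSystem P) :=
  (PiLp.continuous_toLp 2 _).comp <| continuous_pi fun j =>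
    (P j).continuous_eval.comp (PiLp.continuous_ofLp 2 _)

theorem norm_evalSystem_le_systemSupNorm {x : EuclideanSpace ℝ (Fin n)} (hx : ‖x‖ = 1) :
    ‖evalSystem P x‖ ≤ systemSupNorm P := by
  have bounded : BddAbove (Set.range fun u : Metric.sphere (0 : EuclideanSpace ℝ (Fin n)) 1 =>
      ‖evalSystem P u‖) :=
    (isCompact_range ((continuous_evalSystem P).norm.comp continuous_subtype_val)).bddAbove
  exact le_ciSup bounded ⟨x, by simpa using hx⟩

theorem systemSupNorm_nonneg : 0 ≤ systemSupNorm P := Real.iSup_nonneg fun _ => norm_nonneg _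

end SupNorm

noncomputable section GreatCircle

theorem norm_exp_mul_I_le (z : ℂ) : ‖Complex.exp (z * Complex.I)‖ ≤ Real.exp |z.im| := by
  simpa [Complex.norm_exp] using neg_le_abs z.im

theorem norm_cos_le_exp (z : ℂ) : ‖Complex.cos z‖ ≤ Real.exp |z.im| := by
  have hz := norm_exp_mul_I_le z
  have hnz := norm_exp_mul_I_le (-z)
  rw [Complex.neg_im, abs_neg] at hnz
  rw [Complex.cos, norm_div, Complex.norm_two]
  linarith [norm_add_le (Complex.exp (z * Complex.I)) (Complex.exp (-z * Complex.I))]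

theorem norm_sin_le_exp (z : ℂ) : ‖Complex.sin z‖ ≤ Real.exp |z.im| := by
  have hz := norm_exp_mul_I_le z
  have hnz := norm_exp_mul_I_le (-z)
  rw [Complex.neg_im, abs_neg] at hnz
  rw [Complex.sin, norm_div, norm_mul, Complex.norm_I, mul_one, Complex.norm_two]
  linarith [norm_sub_le (Complex.exp (-z * Complex.I)) (Complex.exp (z * Complex.I))]

theorem norm_cos_smul_add_sin_smul {E : Type*} [NormedAddCommGroup E] [InnerProductSpace ℝ E]
    {x y : E} (hx : ‖x‖ = 1) (hy : ‖y‖ = 1) (hxy : inner ℝ x y = 0) (t : ℝ) :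
    ‖Real.cos t • x + Real.sin t • y‖ = 1 := by
  rw [← sq_eq_sq₀ (norm_nonneg _) zero_le_one, norm_add_sq_real, norm_smul, norm_smul,
    real_inner_smul_left, real_inner_smul_right, hx, hy, hxy]
  simp

variable {n m : ℕ} (P : Fin m → MvPolynomial (Fin n) ℝ) (x y : EuclideanSpace ℝ (Fin n))

/-- The parametrisation `cos z • x + sin z • y` of the great circle through the orthogonal unit
vectors `x` and `y`, extended to complex angles `z`. -/
def complexCircle (z : ℂ) (k : Fin n) : ℂ := Complex.cos z * x k + Complex.sin z * y k

/-- The restriction of a polynomial system to the great circle through `x` and `y`, an entire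
function of the angle. -/
def circleSystem (z : ℂ) : EuclideanSpace ℂ (Fin m) :=
  WithLp.toLp 2 fun j => MvPolynomial.aeval (complexCircle x y z) (P j)

theorem norm_circleSystem_ofReal (t : ℝ) :
    ‖circleSystem P x y t‖ = ‖evalSystem P (Real.cos t • x + Real.sin t • y)‖ := by
  have circle_ofReal : complexCircle x y t =
      fun k => (((Real.cos t • x + Real.sin t • y) k : ℝ) : ℂ) := by
    ext k
    simp [complexCircle]
  simp only [EuclideanSpace.norm_eq, circleSystem, evalSystem, circle_ofReal, aeval_ofReal,
    Complex.norm_real]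

theorem norm_circleSystem_zero : ‖circleSystem P x y 0‖ = ‖evalSystem P x‖ := by
  simpa using norm_circleSystem_ofReal P x y 0

theorem hasDerivAt_circleSystem (z : ℂ) :
    HasDerivAt (circleSystem P x y) (WithLp.toLp 2 fun j =>
      ∑ k, MvPolynomial.aeval (complexCircle x y z) (MvPolynomial.pderiv k (P j)) *
        (-Complex.sin z * x k + Complex.cos z * y k)) z :=
  (PiLp.continuousLinearEquiv 2 ℂ fun _ : Fin m => ℂ).symm.hasFDerivAt.comp_hasDerivAt z <|
    hasDerivAt_pi.2 fun j => hasDerivAt_aeval (P j) fun _ =>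
      ((Complex.hasDerivAt_cos z).mul_const _).add ((Complex.hasDerivAt_sin z).mul_const _)

theorem differentiable_circleSystem : Differentiable ℂ (circleSystem P x y) :=
  fun z => (hasDerivAt_circleSystem P x y z).differentiableAt

theorem norm_deriv_circleSystem_zero :
    ‖deriv (circleSystem P x y) 0‖ = ‖jacobianApply P x y‖ := by
  have circle_zero : complexCircle x y 0 = fun k => (x k : ℂ) := by
    ext k
    simp [complexCircle]
  rw [(hasDerivAt_circleSystem P x y 0).deriv, EuclideanSpace.norm_eq, EuclideanSpace.norm_eq]
  simp only [circle_zero, aeval_ofReal, jacobianApply, Complex.sin_zero, Complex.cos_zero,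
    neg_zero, zero_mul, zero_add, one_mul, ← Complex.ofReal_mul, ← Complex.ofReal_sum,
    Complex.norm_real]

theorem norm_complexCircle_le (z : ℂ) (k : Fin n) :
    ‖complexCircle x y z k‖ ≤ (1 + ‖x‖ + ‖y‖) * Real.exp |z.im| :=
  calc ‖complexCircle x y z k‖ ≤ ‖Complex.cos z‖ * ‖x k‖ + ‖Complex.sin z‖ * ‖y k‖ := by
        simpa [complexCircle] using norm_add_le (Complex.cos z * x k) (Complex.sin z * y k)
    _ ≤ Real.exp |z.im| * ‖x‖ + Real.exp |z.im| * ‖y‖ := by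
        gcongr
        exacts [norm_cos_le_exp z, PiLp.norm_apply_le x k, norm_sin_le_exp z,
          PiLp.norm_apply_le y k]
    _ ≤ (1 + ‖x‖ + ‖y‖) * Real.exp |z.im| := by linarith [Real.exp_pos |z.im|]

theorem norm_le_sum_norm_apply {ι : Type*} [Fintype ι] (v : EuclideanSpace ℂ ι) :
    ‖v‖ ≤ ∑ j, ‖v j‖ := by
  rw [EuclideanSpace.norm_eq]
  exact Real.sqrt_le_iff.2 ⟨by positivity,
    Finset.sum_sq_le_sq_sum_of_nonneg fun j _ => norm_nonneg _⟩

variable {P} {D : ℕ}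

theorem exists_norm_circleSystem_le (hP : ∀ j, (P j).totalDegree ≤ D) :
    ∃ K : ℝ, ∀ z : ℂ, ‖circleSystem P x y z‖ ≤ K * Real.exp (D * |z.im|) := by
  set R : ℝ := 1 + ‖x‖ + ‖y‖
  have one_le_R : 1 ≤ R := by linarith [norm_nonneg x, norm_nonneg y]
  refine ⟨∑ j, (∑ s ∈ (P j).support, |(P j).coeff s|) * R ^ D, fun z => ?_⟩
  have one_le_B : 1 ≤ R * Real.exp |z.im| :=
    one_le_mul_of_one_le_of_one_le one_le_R (Real.one_le_exp (abs_nonneg _))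
  rw [Finset.sum_mul]
  refine (norm_le_sum_norm_apply _).trans (Finset.sum_le_sum fun j _ => ?_)
  rw [Real.exp_nat_mul, mul_assoc, ← mul_pow]
  exact norm_aeval_le_pow (hP j) one_le_B (norm_complexCircle_le x y z)

variable {x y}

theorem norm_circleSystem_ofReal_le (hx : ‖x‖ = 1) (hy : ‖y‖ = 1) (hxy : inner ℝ x y = 0)
    (t : ℝ) : ‖circleSystem P x y t‖ ≤ systemSupNorm P := by
  rw [norm_circleSystem_ofReal]
  exact norm_evalSystem_le_systemSupNorm (norm_cos_smul_add_sin_smul hx hy hxy t)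

theorem norm_evalSystem_great_circle_le (hD : 1 ≤ D) (hP : ∀ j, (P j).totalDegree ≤ D)
    (hx : ‖x‖ = 1) (hy : ‖y‖ = 1) (hxy : inner ℝ x y = 0) (t : ℝ) :
    ‖evalSystem P (Real.cos t • x + Real.sin t • y)‖ ≤
      ‖evalSystem P x‖ + D * (Real.exp 1 * systemSupNorm P) * |t| := by
  obtain ⟨K, hK⟩ := exists_norm_circleSystem_le x y hP
  have growth := norm_ofReal_sub_le (differentiable_circleSystem P x y) (by positivity) hK
    (norm_circleSystem_ofReal_le hx hy hxy) 0 t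
  rw [sub_zero, Complex.ofReal_zero] at growth
  rw [← norm_circleSystem_ofReal, ← norm_circleSystem_zero P x y]
  linarith [norm_le_norm_add_norm_sub' (circleSystem P x y t) (circleSystem P x y 0)]

theorem norm_evalSystem_great_circle_le_jacobianApply (hD : 1 ≤ D)
    (hP : ∀ j, (P j).totalDegree ≤ D) (hx : ‖x‖ = 1) (hy : ‖y‖ = 1) (hxy : inner ℝ x y = 0)
    (t : ℝ) :
    ‖evalSystem P (Real.cos t • x + Real.sin t • y)‖ ≤
      ‖evalSystem P x‖ + ‖jacobianApply P x y‖ * |t| +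
        2 * D ^ 2 * (Real.exp 1 * systemSupNorm P) * t ^ 2 := by
  obtain ⟨K, hK⟩ := exists_norm_circleSystem_le x y hP
  have growth := norm_ofReal_sub_le_deriv (differentiable_circleSystem P x y) (by positivity) hK
    (norm_circleSystem_ofReal_le hx hy hxy) 0 t
  rw [sub_zero, Complex.ofReal_zero, norm_deriv_circleSystem_zero] at growth
  rw [← norm_circleSystem_ofReal, ← norm_circleSystem_zero P x y]
  linarith [norm_le_norm_add_norm_sub' (circleSystem P x y t) (circleSystem P x y 0)]

end GreatCircle

section RadialExtension

open NormedSpace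

theorem arctan_le_self {u : ℝ} (hu : 0 ≤ u) : Real.arctan u ≤ u := by
  simpa using Real.le_tan (Real.arctan_nonneg.2 hu) (Real.arctan_lt_pi_div_two u)

theorem abs_arctan_le_abs (u : ℝ) : |Real.arctan u| ≤ |u| := by
  rcases le_total 0 u with hu | hu
  · rw [abs_of_nonneg hu, abs_of_nonneg (Real.arctan_nonneg.2 hu)]
    exact arctan_le_self hu
  · rw [abs_of_nonpos hu, abs_of_nonpos (Real.arctan_le_zero.2 hu), ← Real.arctan_neg]
    exact arctan_le_self (neg_nonneg.2 hu)

section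

variable {E : Type*} [NormedAddCommGroup E] [InnerProductSpace ℝ E] {x y : E} {p : ℝ}

theorem exists_normalize_smul_add_smul_eq (hx : ‖x‖ = 1) (hy : ‖y‖ = 1) (hxy : inner ℝ x y = 0)
    (hp : 0 < p) (q : ℝ) :
    ∃ t : ℝ, |t| ≤ |q| / p ∧ normalize (p • x + q • y) = Real.cos t • x + Real.sin t • y := by
  have hs : 0 < √(1 + (q / p) ^ 2) := Real.sqrt_pos.2 (by positivity)
  refine ⟨Real.arctan (q / p), ?_, ?_⟩
  · simpa [abs_div, abs_of_pos hp] using abs_arctan_le_abs (q / p)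
  have polar : p • x + q • y = (p * √(1 + (q / p) ^ 2)) •
      (Real.cos (Real.arctan (q / p)) • x + Real.sin (Real.arctan (q / p)) • y) := by
    rw [Real.cos_arctan, Real.sin_arctan, smul_add, smul_smul, smul_smul]
    congr 2 <;> field_simp
  rw [polar, normalize_smul_of_pos (mul_pos hp hs),
    normalize_eq_self_of_norm_eq_one (norm_cos_smul_add_sin_smul hx hy hxy _)]

theorem le_norm_smul_add_smul (hx : ‖x‖ = 1) (hxy : inner ℝ x y = 0) (p q : ℝ) :
    p ≤ ‖p • x + q • y‖ := by
  have inner_eq : inner ℝ x (p • x + q • y) = p := by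
    simp [inner_add_right, real_inner_smul_right, hx, hxy]
  simpa [inner_eq, hx] using real_inner_le_norm x (p • x + q • y)

end

variable {n m D : ℕ} {P : Fin m → MvPolynomial (Fin n) ℝ} {x y z : EuclideanSpace ℝ (Fin n)}
  {p : ℝ}

theorem norm_evalSystem_normalize_smul_add_le (hD : 1 ≤ D) (hP : ∀ j, (P j).totalDegree ≤ D)
    (hx : ‖x‖ = 1) (hxz : inner ℝ x z = 0) (hp : 0 < p) :
    ‖evalSystem P (normalize (p • x + z))‖ ≤
      ‖evalSystem P x‖ + D * (Real.exp 1 * systemSupNorm P) * (‖z‖ / p) := by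
  rcases eq_or_ne z 0 with rfl | hz
  · simp [normalize_smul_of_pos hp, normalize_eq_self_of_norm_eq_one hx]
  have hxz' : inner ℝ x (normalize z) = 0 := by
    simp [NormedSpace.normalize, real_inner_smul_right, hxz]
  obtain ⟨t, ht, hu⟩ :=
    exists_normalize_smul_add_smul_eq hx (norm_normalize hz) hxz' hp ‖z‖
  rw [norm_smul_normalize] at hu
  rw [abs_norm] at ht
  have := systemSupNorm_nonneg (P := P)
  calc ‖evalSystem P (normalize (p • x + z))‖
      ≤ ‖evalSystem P x‖ + D * (Real.exp 1 * systemSupNorm P) * |t| := by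
        rw [hu]
        exact norm_evalSystem_great_circle_le hD hP hx (norm_normalize hz) hxz' t
    _ ≤ ‖evalSystem P x‖ + D * (Real.exp 1 * systemSupNorm P) * (‖z‖ / p) := by gcongr

theorem norm_evalSystem_normalize_smul_add_smul_le (hD : 1 ≤ D)
    (hP : ∀ j, (P j).totalDegree ≤ D) (hx : ‖x‖ = 1) (hy : ‖y‖ = 1) (hxy : inner ℝ x y = 0)
    (hp : 0 < p) (q : ℝ) :
    ‖evalSystem P (normalize (p • x + q • y))‖ ≤
      ‖evalSystem P x‖ + ‖jacobianApply P x y‖ * (|q| / p) +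
        2 * D ^ 2 * (Real.exp 1 * systemSupNorm P) * (|q| / p) ^ 2 := by
  obtain ⟨t, ht, hu⟩ := exists_normalize_smul_add_smul_eq hx hy hxy hp q
  have := systemSupNorm_nonneg (P := P)
  calc ‖evalSystem P (normalize (p • x + q • y))‖
      ≤ ‖evalSystem P x‖ + ‖jacobianApply P x y‖ * |t| +
          2 * D ^ 2 * (Real.exp 1 * systemSupNorm P) * |t| ^ 2 := by
        rw [hu, sq_abs]
        exact norm_evalSystem_great_circle_le_jacobianApply hD hP hx hy hxy t
    _ ≤ ‖evalSystem P x‖ + ‖jacobianApply P x y‖ * (|q| / p) +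
          2 * D ^ 2 * (Real.exp 1 * systemSupNorm P) * (|q| / p) ^ 2 := by gcongr

theorem norm_evalSystem_normalize_smul_add_smul_add_le (hD : 1 ≤ D)
    (hP : ∀ j, (P j).totalDegree ≤ D) (hx : ‖x‖ = 1) (hy : ‖y‖ = 1) (hxy : inner ℝ x y = 0)
    (hxz : inner ℝ x z = 0) (hyz : inner ℝ y z = 0) (hp : 0 < p) (q : ℝ) :
    ‖evalSystem P (normalize (p • x + q • y + z))‖ ≤
      ‖evalSystem P x‖ + ‖jacobianApply P x y‖ * (|q| / p) +
        2 * D ^ 2 * (Real.exp 1 * systemSupNorm P) * (|q| / p) ^ 2 +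
        D * (Real.exp 1 * systemSupNorm P) * (‖z‖ / p) := by
  set w := p • x + q • y
  have p_le_norm_w : p ≤ ‖w‖ := le_norm_smul_add_smul hx hxy p q
  have norm_w_pos : 0 < ‖w‖ := hp.trans_le p_le_norm_w
  have inner_w_z : inner ℝ (normalize w) z = 0 := by
    simp [w, NormedSpace.normalize, inner_add_left, real_inner_smul_left, hxz, hyz]
  have transverse_growth := norm_evalSystem_normalize_smul_add_le hD hP
    (norm_normalize (norm_pos_iff.1 norm_w_pos)) inner_w_z norm_w_pos
  rw [norm_smul_normalize] at transverse_growth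
  have planar_growth := norm_evalSystem_normalize_smul_add_smul_le hD hP hx hy hxy hp q
  have := systemSupNorm_nonneg (P := P)
  have : D * (Real.exp 1 * systemSupNorm P) * (‖z‖ / ‖w‖) ≤
      D * (Real.exp 1 * systemSupNorm P) * (‖z‖ / p) := by gcongr
  linarith

end RadialExtension

noncomputable section PlanarScaling

open MeasureTheory ProbabilityTheory Metric

theorem det_eq_prod_of_apply_basis {R M ι : Type*} [CommRing R] [AddCommGroup M] [Module R M]
    [Fintype ι] (b : Module.Basis ι R M) {f : M →ₗ[R] M} {c : ι → R}
    (hf : ∀ i, f (b i) = c i • b i) : LinearMap.det f = ∏ i, c i := by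
  classical
  have toMatrix_eq : LinearMap.toMatrix b b f = Matrix.diagonal c := by
    ext i j
    rcases eq_or_ne i j with rfl | hij
    · simp [LinearMap.toMatrix_apply, hf]
    · simp [LinearMap.toMatrix_apply, hf, hij]
  rw [← LinearMap.det_toMatrix b, toMatrix_eq, Matrix.det_diagonal]

variable {E : Type*} [NormedAddCommGroup E] [InnerProductSpace ℝ E] {x y v : E} {β ε : ℝ}

theorem abs_inner_left_sub_one_le (hx : ‖x‖ = 1) (hv : v ∈ ball x (1 / 2)) :
    |inner ℝ x v - 1| ≤ 1 / 2 := by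
  have inner_eq : inner ℝ x v - 1 = inner ℝ x (v - x) := by simp [inner_sub_right, hx]
  rw [inner_eq]
  simpa [hx] using (abs_real_inner_le_norm x (v - x)).trans
    (by simpa [hx] using (mem_ball_iff_norm.1 hv).le)

theorem abs_inner_right_le (hy : ‖y‖ = 1) (hxy : inner ℝ x y = 0) (hv : v ∈ ball x (1 / 2)) :
    |inner ℝ y v| ≤ 1 / 2 := by
  have inner_eq : inner ℝ y v = inner ℝ y (v - x) := by
    simp [inner_sub_right, real_inner_comm, hxy]
  rw [inner_eq]
  exact (abs_real_inner_le_norm y (v - x)).trans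
    (by simpa [hy] using (mem_ball_iff_norm.1 hv).le)

variable [FiniteDimensional ℝ E]

/-- The orthogonal projection onto the complement of the plane spanned by `x` and `y`. -/
def transversePart (x y : E) : E →L[ℝ] E := (Submodule.span ℝ {x, y})ᗮ.starProjection

theorem transversePart_left : transversePart x y x = 0 :=
  Submodule.starProjection_orthogonal_apply_eq_zero (Submodule.subset_span (by simp))

theorem transversePart_right : transversePart x y y = 0 :=
  Submodule.starProjection_orthogonal_apply_eq_zero (Submodule.subset_span (by simp))

theorem transversePart_of_inner_eq_zero (hx : inner ℝ x v = 0) (hy : inner ℝ y v = 0) :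
    transversePart x y v = v := by
  refine Submodule.starProjection_eq_self_iff.2 ((Submodule.mem_orthogonal _ _).2 fun u hu => ?_)
  obtain ⟨a, b, rfl⟩ := Submodule.mem_span_pair.1 hu
  simp [inner_add_left, real_inner_smul_left, hx, hy]

theorem inner_left_transversePart (v : E) : inner ℝ x (transversePart x y v) = 0 :=
  Submodule.inner_right_of_mem_orthogonal (Submodule.subset_span (by simp))
    (Submodule.starProjection_apply_mem _ v)

theorem inner_right_transversePart (v : E) : inner ℝ y (transversePart x y v) = 0 :=
  Submodule.inner_right_of_mem_orthogonal (Submodule.subset_span (by simp))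
    (Submodule.starProjection_apply_mem _ v)

/-- The linear map that fixes `x`, scales `y` by `β` and scales the orthogonal complement of the
plane of `x` and `y` by `ε` (for orthonormal `x` and `y`). -/
def planarScaling (x y : E) (β ε : ℝ) : E →ₗ[ℝ] E :=
  (innerₛₗ ℝ x).smulRight x + β • (innerₛₗ ℝ y).smulRight y + ε • (transversePart x y).toLinearMap

theorem planarScaling_apply (v : E) : planarScaling x y β ε v =
    inner ℝ x v • x + (β * inner ℝ y v) • y + ε • transversePart x y v := by
  simp [planarScaling, smul_smul]

theorem det_planarScaling {k : ℕ} (hE : Module.finrank ℝ E = k + 2)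
    (hx : ‖x‖ = 1) (hy : ‖y‖ = 1) (hxy : inner ℝ x y = 0) :
    LinearMap.det (planarScaling x y β ε) = β * ε ^ k := by
  have hyx : inner ℝ y x = 0 := by rw [real_inner_comm, hxy]
  set v : Fin (k + 2) → E := Fin.cons x (Fin.cons y 0)
  have orthonormal_v : Orthonormal ℝ (Set.domRestrict ({0, 1} : Set (Fin (k + 2))) v) := by
    rw [orthonormal_iff_ite]
    rintro ⟨i, rfl | rfl⟩ ⟨j, rfl | rfl⟩ <;> simp [v, hxy, hyx, hx, hy, Subtype.ext_iff]
  obtain ⟨b, hb⟩ := orthonormal_v.exists_orthonormalBasis_extension_of_card_eq (by simpa using hE)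
  have hb0 : b 0 = x := hb 0 (by simp)
  have hb1 : b 1 = y := hb 1 (by simp)
  have planarScaling_basis (i : Fin (k + 2)) : planarScaling x y β ε (b.toBasis i) =
      (Fin.cons 1 (Fin.cons β fun _ => ε) : Fin (k + 2) → ℝ) i • b.toBasis i := by
    rw [b.coe_toBasis, planarScaling_apply]
    refine Fin.cases ?_ (fun i => Fin.cases ?_ (fun i => ?_) i) i
    · simp [hb0, hx, hyx, transversePart_left]
    · simp [hb1, hy, hxy, transversePart_right]
    · have inner_x : inner ℝ x (b i.succ.succ) = 0 := by
        rw [← hb0, b.inner_eq_zero (Fin.succ_ne_zero _).symm]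
      have inner_y : inner ℝ y (b i.succ.succ) = 0 := by
        rw [← hb1, b.inner_eq_zero (by simp [Fin.ext_iff])]
      simp [inner_x, inner_y, transversePart_of_inner_eq_zero]
  simp [det_eq_prod_of_apply_basis b.toBasis planarScaling_basis, Fin.prod_univ_succ]

theorem norm_transversePart_le (hv : v ∈ ball x (1 / 2)) : ‖transversePart x y v‖ ≤ 1 / 2 := by
  have transversePart_eq : transversePart x y v = transversePart x y (v - x) := by
    rw [map_sub, transversePart_left, sub_zero]
  rw [transversePart_eq]
  exact (Submodule.norm_starProjection_apply_le _ _).trans (mem_ball_iff_norm.1 hv).le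

theorem planarScaling_mem_ball (hx : ‖x‖ = 1) (hy : ‖y‖ = 1) (hxy : inner ℝ x y = 0) (hβ : 0 < β)
    (hβ8 : β ^ 2 ≤ 8) (hv : v ∈ ball x (1 / 2)) : planarScaling x y β (β ^ 2) v ∈ ball 0 8 := by
  have inner_x : |inner ℝ x v| ≤ 3 / 2 := by
    have := abs_le.1 (abs_inner_left_sub_one_le hx hv)
    exact abs_le.2 ⟨by linarith, by linarith⟩
  have hβ3 : β ≤ 3 := by nlinarith
  rw [mem_ball_zero_iff, planarScaling_apply]
  calc ‖inner ℝ x v • x + (β * inner ℝ y v) • y + β ^ 2 • transversePart x y v‖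
      ≤ |inner ℝ x v| + β * |inner ℝ y v| + β ^ 2 * ‖transversePart x y v‖ := by
        refine norm_add₃_le.trans_eq ?_
        rw [norm_smul, norm_smul, norm_smul, hx, hy, Real.norm_eq_abs, Real.norm_eq_abs,
          Real.norm_of_nonneg (sq_nonneg β), abs_mul, abs_of_pos hβ, mul_one, mul_one]
    _ ≤ 3 / 2 + 3 * (1 / 2) + 8 * (1 / 2) := by
        gcongr
        exacts [abs_inner_right_le hy hxy hv, norm_transversePart_le hv]
    _ < 8 := by norm_num

variable [MeasurableSpace E] [BorelSpace E] {k : ℕ}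

theorem cond_ball_real_image_planarScaling (hE : Module.finrank ℝ E = k + 2) (hx : ‖x‖ = 1)
    (hy : ‖y‖ = 1) (hxy : inner ℝ x y = 0) (hβ : 0 < β) (hβ8 : β ^ 2 ≤ 8) :
    (volume[|ball (0 : E) 8]).real (planarScaling x y β (β ^ 2) '' ball x (1 / 2)) =
      β ^ (2 * k + 1) / 16 ^ (k + 2) := by
  have image_subset : planarScaling x y β (β ^ 2) '' ball x (1 / 2) ⊆ ball 0 8 :=
    Set.image_subset_iff.2 fun v hv => planarScaling_mem_ball hx hy hxy hβ hβ8 hv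
  have volume_image : volume.real (planarScaling x y β (β ^ 2) '' ball x (1 / 2)) =
      β ^ (2 * k + 1) * volume.real (ball (0 : E) (1 / 2)) := by
    rw [measureReal_def, Measure.addHaar_image_linearMap, det_planarScaling hE hx hy hxy,
      abs_of_pos (by positivity), Measure.addHaar_ball_center, ENNReal.toReal_mul,
      ENNReal.toReal_ofReal (by positivity), ← measureReal_def]
    ring
  have volume_ball :
      volume.real (ball (0 : E) 8) = 16 ^ (k + 2) * volume.real (ball (0 : E) (1 / 2)) := by
    rw [show (8 : ℝ) = 16 * (1 / 2) by norm_num, measureReal_def,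
      Measure.addHaar_ball_mul_of_pos _ _ (by norm_num), hE, ENNReal.toReal_mul,
      ENNReal.toReal_ofReal (by positivity), ← measureReal_def]
  have volume_ball_pos : 0 < volume.real (ball (0 : E) (1 / 2)) :=
    ENNReal.toReal_pos (measure_ball_pos _ _ (by norm_num)).ne' measure_ball_lt_top.ne
  rw [measureReal_def, cond_apply measurableSet_ball,
    Set.inter_eq_self_of_subset_right image_subset, ENNReal.toReal_mul, ENNReal.toReal_inv,
    ← measureReal_def, ← measureReal_def, volume_image, volume_ball]
  field_simp

end PlanarScaling

section Patch

open Metric NormedSpace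

variable {n m D : ℕ} {P : Fin m → MvPolynomial (Fin n) ℝ} {x y v : EuclideanSpace ℝ (Fin n)}
  {β : ℝ}

theorem norm_evalSystem_normalize_planarScaling_le (hD : 1 ≤ D)
    (hP : ∀ j, (P j).totalDegree ≤ D) (hx : ‖x‖ = 1) (hy : ‖y‖ = 1) (hxy : inner ℝ x y = 0)
    (hβ : 0 < β) (hv : v ∈ ball x (1 / 2)) :
    ‖evalSystem P (normalize (planarScaling x y β (β ^ 2) v))‖ ≤
      ‖evalSystem P x‖ + ‖jacobianApply P x y‖ * β +
        3 * D ^ 2 * (Real.exp 1 * systemSupNorm P) * β ^ 2 := by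
  set p : ℝ := inner ℝ x v
  have half_le_p : 1 / 2 ≤ p := by
    linarith [(abs_le.1 (abs_inner_left_sub_one_le hx hv)).1]
  have p_pos : 0 < p := by linarith
  have planar_slope : |β * inner ℝ y v| / p ≤ β := by
    rw [abs_mul, abs_of_pos hβ, div_le_iff₀ p_pos]
    gcongr
    exact (abs_inner_right_le hy hxy hv).trans half_le_p
  have transverse_slope : ‖β ^ 2 • transversePart x y v‖ / p ≤ β ^ 2 := by
    rw [norm_smul, Real.norm_of_nonneg (by positivity), div_le_iff₀ p_pos]
    gcongr
    exact (norm_transversePart_le hv).trans half_le_p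
  have := systemSupNorm_nonneg (P := P)
  have D_le : (D : ℝ) ≤ D ^ 2 := by exact_mod_cast Nat.le_self_pow two_ne_zero D
  rw [planarScaling_apply]
  calc ‖evalSystem P (normalize (p • x + (β * inner ℝ y v) • y + β ^ 2 • transversePart x y v))‖
      ≤ ‖evalSystem P x‖ + ‖jacobianApply P x y‖ * (|β * inner ℝ y v| / p) +
          2 * D ^ 2 * (Real.exp 1 * systemSupNorm P) * (|β * inner ℝ y v| / p) ^ 2 +
          D * (Real.exp 1 * systemSupNorm P) * (‖β ^ 2 • transversePart x y v‖ / p) :=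
        norm_evalSystem_normalize_smul_add_smul_add_le hD hP hx hy hxy
          (by simp [real_inner_smul_right, inner_left_transversePart])
          (by simp [real_inner_smul_right, inner_right_transversePart]) p_pos _
    _ ≤ ‖evalSystem P x‖ + ‖jacobianApply P x y‖ * β +
          2 * D ^ 2 * (Real.exp 1 * systemSupNorm P) * β ^ 2 +
          D ^ 2 * (Real.exp 1 * systemSupNorm P) * β ^ 2 := by gcongr
    _ = _ := by ring

end Patch

section SmallBallTensorization

open MeasureTheory ProbabilityTheory

variable {Ω : Type*} [MeasurableSpace Ω] {μ : Measure Ω}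

theorem integrable_exp_neg_mul_abs [IsFiniteMeasure μ] {X : Ω → ℝ} (hX : Measurable X) {s : ℝ}
    (hs : 0 ≤ s) : Integrable (fun ω => Real.exp (-s * |X ω|)) μ := by
  refine Integrable.of_bound (by fun_prop) 1 (ae_of_all _ fun ω => ?_)
  simpa using mul_nonneg hs (abs_nonneg (X ω))

theorem mgf_abs_neg_le [IsFiniteMeasure μ] {X : Ω → ℝ} (hX : Measurable X) {c s : ℝ} (hs : 0 < s)
    (h : ∀ ε > 0, μ.real {ω | |X ω| ≤ ε} ≤ c * ε) :
    mgf (fun ω => |X ω|) μ (-s) ≤ c / s := by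
  have integrableOn_log : IntegrableOn Real.log (Set.Ioo 0 1) :=
    (intervalIntegral.intervalIntegrable_log' (a := 0) (b := 1)).1.mono_set Set.Ioo_subset_Ioc_self
  have superlevel_le : ∀ u ∈ Set.Ioo (0 : ℝ) 1,
      μ.real {ω | u ≤ Real.exp (-s * |X ω|)} ≤ -(c / s) * Real.log u := by
    intro u hu
    have set_eq : {ω | u ≤ Real.exp (-s * |X ω|)} = {ω | |X ω| ≤ -Real.log u / s} := by
      ext ω
      rw [Set.mem_ofPred_eq, Set.mem_ofPred_eq, ← Real.log_le_iff_le_exp hu.1, le_div_iff₀ hs]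
      constructor <;> intro <;> linarith
    rw [set_eq]
    refine (h _ (div_pos (neg_pos.2 (Real.log_neg hu.1 hu.2)) hs)).trans_eq ?_
    ring
  calc mgf (fun ω => |X ω|) μ (-s)
      = ∫ u in Set.Ioo 0 1, μ.real {ω | u ≤ Real.exp (-s * |X ω|)} := by
        rw [mgf, (integrable_exp_neg_mul_abs hX hs.le).integral_eq_integral_Ioc_meas_le (M := 1)
          (ae_of_all _ fun ω => (Real.exp_pos _).le) (ae_of_all _ fun ω => ?_),
          integral_Ioc_eq_integral_Ioo]
        simpa using mul_nonneg hs.le (abs_nonneg (X ω))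
    _ ≤ ∫ u in Set.Ioo 0 1, -(c / s) * Real.log u :=
        integral_mono_of_nonneg (ae_of_all _ fun _ => measureReal_nonneg)
          (integrableOn_log.const_mul _)
          ((ae_restrict_iff' measurableSet_Ioo).2 (ae_of_all _ superlevel_le))
    _ = c / s := by
        rw [integral_const_mul, ← integral_Ioc_eq_integral_Ioo,
          ← intervalIntegral.integral_of_le zero_le_one, integral_log]
        simp

section

variable [IsProbabilityMeasure μ] {ι : Type*} [Fintype ι] {X : ι → Ω → ℝ} {c : ℝ}

theorem measureReal_sum_abs_le (hX : ∀ j, Measurable (X j)) (hindep : iIndepFun X μ)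
    (h : ∀ j, ∀ ε > 0, μ.real {ω | |X j ω| ≤ ε} ≤ c * ε) {s : ℝ} (hs : 0 < s) (r : ℝ) :
    μ.real {ω | ∑ j, |X j ω| ≤ r} ≤ Real.exp (s * r) * (c / s) ^ Fintype.card ι := by
  set S : Ω → ℝ := ∑ j, fun ω => |X j ω|
  have S_apply (ω : Ω) : S ω = ∑ j, |X j ω| := Finset.sum_apply _ _ _
  have measurable_S : Measurable S := by fun_prop
  have abs_S (ω : Ω) : |S ω| = S ω := abs_of_nonneg (by rw [S_apply]; positivity)
  have mgf_S_le : mgf S μ (-s) ≤ (c / s) ^ Fintype.card ι := by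
    have hindep_abs : iIndepFun (fun j ω => |X j ω|) μ :=
      hindep.comp (fun _ => abs) fun _ => measurable_abs
    rw [hindep_abs.mgf_sum fun j => (hX j).abs]
    exact (Finset.prod_le_prod (fun _ _ => mgf_nonneg)
      fun j _ => mgf_abs_neg_le (hX j) hs (h j)).trans_eq (by simp [div_pow])
  simp only [← S_apply]
  calc μ.real {ω | S ω ≤ r} ≤ Real.exp (- -s * r) * mgf S μ (-s) :=
        measure_le_le_exp_mul_mgf _ (by linarith)
          (by simpa only [abs_S] using integrable_exp_neg_mul_abs measurable_S hs.le)
    _ ≤ Real.exp (s * r) * (c / s) ^ Fintype.card ι := by rw [neg_neg]; gcongr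

theorem measureReal_sum_sq_le [Nonempty ι] (hX : ∀ j, Measurable (X j)) (hindep : iIndepFun X μ)
    (h : ∀ j, ∀ ε > 0, μ.real {ω | |X j ω| ≤ ε} ≤ c * ε) {t : ℝ} (ht : 0 < t) :
    μ.real {ω | ∑ j, X j ω ^ 2 ≤ t ^ 2} ≤
      (Real.exp 1 * c * t / √(Fintype.card ι)) ^ Fintype.card ι := by
  set m := Fintype.card ι
  have hm : (0 : ℝ) < m := Nat.cast_pos.2 Fintype.card_pos
  have sublevel_subset : {ω | ∑ j, X j ω ^ 2 ≤ t ^ 2} ⊆ {ω | ∑ j, |X j ω| ≤ √m * t} := by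
    intro ω (hω : ∑ j, X j ω ^ 2 ≤ t ^ 2)
    have cauchy_schwarz := sq_sum_le_card_mul_sum_sq (s := Finset.univ) (f := fun j => |X j ω|)
    simp only [sq_abs, Finset.card_univ] at cauchy_schwarz
    refine abs_le_of_sq_le_sq' (?_ : (∑ j, |X j ω|) ^ 2 ≤ (√m * t) ^ 2) (by positivity) |>.2
    calc (∑ j, |X j ω|) ^ 2 ≤ m * ∑ j, X j ω ^ 2 := cauchy_schwarz
      _ ≤ m * t ^ 2 := by gcongr
      _ = (√m * t) ^ 2 := by rw [mul_pow, Real.sq_sqrt hm.le]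
  have exponent_eq : √m / t * (√m * t) = m := by
    rw [div_mul_eq_mul_div, mul_div_assoc, mul_div_cancel_right₀ _ ht.ne', Real.mul_self_sqrt hm.le]
  calc μ.real {ω | ∑ j, X j ω ^ 2 ≤ t ^ 2} ≤ μ.real {ω | ∑ j, |X j ω| ≤ √m * t} :=
        measureReal_mono sublevel_subset
    _ ≤ Real.exp (√m / t * (√m * t)) * (c / (√m / t)) ^ m :=
        measureReal_sum_abs_le hX hindep h (by positivity) _
    _ = (Real.exp 1 * c * t / √m) ^ m := by
        rw [exponent_eq, ← mul_one (m : ℝ), Real.exp_nat_mul, ← mul_pow, mul_one,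
          div_div_eq_mul_div]
        ring

end

end SmallBallTensorization

noncomputable section WeylForms

open MeasureTheory ProbabilityTheory

variable {n d : ℕ}

/-- The vector of coefficients of the linear functional `c ↦ weylForm c x`: the Weyl-scaled
monomials of degree `d` at `x`. -/
def weylVector (d : ℕ) (x : EuclideanSpace ℝ (Fin n)) : EuclideanSpace ℝ (ExponentIndex n d) :=
  WithLp.toLp 2 fun a => √(Nat.multinomial Finset.univ a.1 : ℝ) * ∏ k, x k ^ a.1 k

theorem eval_weylForm (c : EuclideanSpace ℝ (ExponentIndex n d)) (x : EuclideanSpace ℝ (Fin n)) :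
    MvPolynomial.eval (fun k => x k) (weylForm c) = inner ℝ (weylVector d x) c := by
  rw [weylForm, map_sum, PiLp.inner_apply]
  refine Finset.sum_congr rfl fun a _ => ?_
  rw [MvPolynomial.eval_monomial, Finsupp.prod_fintype _ _ (by simp)]
  simp only [weylVector, Finsupp.equivFunOnFinite_symm_apply_apply, RCLike.inner_apply,
    conj_trivial]
  ring

-- The Weyl scaling is made so that this follows from the multinomial theorem.
theorem norm_weylVector (x : EuclideanSpace ℝ (Fin n)) : ‖weylVector d x‖ = ‖x‖ ^ d := by
  rw [← sq_eq_sq₀ (norm_nonneg _) (by positivity), pow_right_comm, EuclideanSpace.norm_sq_eq,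
    EuclideanSpace.norm_sq_eq, Finset.sum_pow_eq_sum_piAntidiag,
    ← Finset.sum_coe_sort (Finset.piAntidiag _ _)]
  refine Finset.sum_congr rfl fun a _ => ?_
  simp only [weylVector, Real.norm_eq_abs, sq_abs, mul_pow, Real.sq_sqrt (Nat.cast_nonneg _),
    ← Finset.prod_pow, pow_right_comm _ 2]

theorem totalDegree_weylForm_le (c : EuclideanSpace ℝ (ExponentIndex n d)) :
    (weylForm c).totalDegree ≤ d := by
  refine MvPolynomial.totalDegree_finsetSum_le fun a _ => ?_
  refine (MvPolynomial.totalDegree_monomial_le _ _).trans_eq ?_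
  rw [Finsupp.sum_fintype _ _ (by simp)]
  simpa using (Finset.mem_piAntidiag.1 a.2).1

variable {m : ℕ} {d : Fin m → ℕ}

theorem norm_sq_evalSystem_weylForm (c : ∀ j, EuclideanSpace ℝ (ExponentIndex n (d j)))
    (x : EuclideanSpace ℝ (Fin n)) :
    ‖evalSystem (fun j => weylForm (c j)) x‖ ^ 2 =
      ∑ j, inner ℝ (weylVector (d j) x) (c j) ^ 2 := by
  simp only [EuclideanSpace.norm_sq_eq, evalSystem, eval_weylForm, Real.norm_eq_abs, sq_abs]

variable {Ω : Type*} [MeasurableSpace Ω] {μ : Measure Ω}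
  {c : ∀ j, Ω → EuclideanSpace ℝ (ExponentIndex n (d j))}

theorem measurable_norm_evalSystem_weylForm (hc : ∀ j, Measurable (c j))
    {x : Ω → EuclideanSpace ℝ (Fin n)} (hx : Measurable x) :
    Measurable fun ω => ‖evalSystem (fun j => weylForm (c j ω)) (x ω)‖ := by
  have norm_eq (ω : Ω) : ‖evalSystem (fun j => weylForm (c j ω)) (x ω)‖ =
      √(∑ j, inner ℝ (weylVector (d j) (x ω)) (c j ω) ^ 2) := by
    rw [← norm_sq_evalSystem_weylForm, Real.sqrt_sq (norm_nonneg _)]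
  simp only [norm_eq, weylVector]
  fun_prop

theorem measureReal_norm_evalSystem_weylForm_le [IsProbabilityMeasure μ] (hm : 1 ≤ m)
    (hc : ∀ j, Measurable (c j)) (hindep : iIndepFun c μ) {c₀ t : ℝ}
    (hsmall : ∀ j, SmallBall μ (c j) c₀) {x : EuclideanSpace ℝ (Fin n)} (hx : ‖x‖ = 1)
    (ht : 0 < t) :
    μ.real {ω | ‖evalSystem (fun j => weylForm (c j ω)) x‖ ≤ t} ≤
      (Real.exp 1 * c₀ * t / √m) ^ m := by
  have : NeZero m := ⟨by omega⟩
  have norm_weylVector_eq_one (j : Fin m) : ‖weylVector (d j) x‖ = 1 := by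
    rw [norm_weylVector, hx, one_pow]
  have small_ball := measureReal_sum_sq_le (μ := μ) (c := c₀)
    (X := fun j ω => inner ℝ (weylVector (d j) x) (c j ω)) (fun j => by fun_prop)
    (hindep.comp (fun j v => inner ℝ (weylVector (d j) x) v) fun j => by fun_prop)
    (fun j ε hε => by
      simpa [norm_weylVector_eq_one] using
        hsmall j (weylVector (d j) x) (norm_ne_zero_iff.1 (by simp [norm_weylVector_eq_one])) ε hε)
    ht
  simpa only [← norm_sq_evalSystem_weylForm, Fintype.card_fin,
    pow_le_pow_iff_left₀ (norm_nonneg _) ht.le two_ne_zero] using small_ball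

end WeylForms

section FubiniMarkov

open MeasureTheory

variable {Ω : Type*} [MeasurableSpace Ω] {μ : Measure Ω} [IsFiniteMeasure μ]

theorem measureReal_le_measureReal_prodMk_preimage_le {F : Type*} [MeasurableSpace F]
    {ν : Measure F} [IsProbabilityMeasure ν] {A : Set (Ω × F)} (hA : MeasurableSet A) {q ρ : ℝ}
    (hρ : 0 < ρ) (h : ∀ᵐ w ∂ν, μ.real ((fun ω => (ω, w)) ⁻¹' A) ≤ q) :
    μ.real {ω | ρ ≤ ν.real (Prod.mk ω ⁻¹' A)} ≤ q / ρ := by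
  have q_nonneg : 0 ≤ q := h.exists.elim fun _ hw => measureReal_nonneg.trans hw
  have prod_A_le : (μ.prod ν).real A ≤ q := by
    refine ENNReal.toReal_le_of_le_ofReal q_nonneg ?_
    calc μ.prod ν A = ∫⁻ w, μ ((fun ω => (ω, w)) ⁻¹' A) ∂ν := Measure.prod_apply_symm hA
      _ ≤ ∫⁻ _, ENNReal.ofReal q ∂ν := lintegral_mono_ae <| h.mono fun w hw =>
          (ofReal_measureReal (μ := μ)).symm.trans_le (ENNReal.ofReal_le_ofReal hw)
      _ = ENNReal.ofReal q := by simp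
  rw [le_div_iff₀' hρ]
  calc ρ * μ.real {ω | ρ ≤ ν.real (Prod.mk ω ⁻¹' A)}
      ≤ ∫ ω, ν.real (Prod.mk ω ⁻¹' A) ∂μ :=
        mul_meas_ge_le_integral_of_nonneg (ae_of_all _ fun _ => measureReal_nonneg)
          (Measure.integrable_measure_prodMk_left hA (measure_ne_top _ _)) ρ
    _ = (μ.prod ν).real A := by
        rw [measureReal_def, Measure.prod_apply hA]
        exact integral_toReal (measurable_measure_prodMk_left hA).aemeasurable
          (ae_of_all _ fun _ => measure_lt_top _ _)
    _ ≤ q := prod_A_le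

end FubiniMarkov

section RandomPoint

open MeasureTheory ProbabilityTheory NormedSpace

theorem measureReal_le_measureReal_norm_evalSystem_normalize_le {Ω : Type*} [MeasurableSpace Ω]
    {μ : Measure Ω} [IsProbabilityMeasure μ] {n m : ℕ} {d : Fin m → ℕ} (hm : 1 ≤ m)
    {c : ∀ j, Ω → EuclideanSpace ℝ (ExponentIndex n (d j))} (hc : ∀ j, Measurable (c j))
    (hindep : iIndepFun c μ) {c₀ t ρ : ℝ} (hsmall : ∀ j, SmallBall μ (c j) c₀) (ht : 0 < t)
    (hρ : 0 < ρ) {ν : Measure (EuclideanSpace ℝ (Fin n))} [IsProbabilityMeasure ν]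
    (hν : ∀ᵐ w ∂ν, w ≠ 0) :
    μ.real {ω | ρ ≤ ν.real {w | ‖evalSystem (fun j => weylForm (c j ω)) (normalize w)‖ ≤ t}} ≤
      (Real.exp 1 * c₀ * t / √m) ^ m / ρ := by
  have measurable_normalize_snd :
      Measurable fun z : Ω × EuclideanSpace ℝ (Fin n) => NormedSpace.normalize z.2 := by
    unfold NormedSpace.normalize
    fun_prop
  have measurable_norm_eval : Measurable fun z : Ω × EuclideanSpace ℝ (Fin n) =>
      ‖evalSystem (fun j => weylForm (c j z.1)) (normalize z.2)‖ :=
    measurable_norm_evalSystem_weylForm (fun j => (hc j).comp measurable_fst)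
      measurable_normalize_snd
  have section_le : ∀ᵐ w ∂ν,
      μ.real {ω | ‖evalSystem (fun j => weylForm (c j ω)) (normalize w)‖ ≤ t} ≤
        (Real.exp 1 * c₀ * t / √m) ^ m :=
    hν.mono fun w hw =>
      measureReal_norm_evalSystem_weylForm_le hm hc hindep hsmall (norm_normalize hw) ht
  exact measureReal_le_measureReal_prodMk_preimage_le
    (measurableSet_le measurable_norm_eval measurable_const) hρ section_le

end RandomPoint

section SmallSystemL

open MeasureTheory ProbabilityTheory Metric NormedSpace

variable {n m D : ℕ} {d : Fin m → ℕ} {P : Fin m → MvPolynomial (Fin n) ℝ}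
  {x y : EuclideanSpace ℝ (Fin n)}

theorem exists_scriptL_lt_of_systemL_lt (hn : 2 ≤ n) {r : ℝ} (h : systemL d P < r) :
    ∃ x y : EuclideanSpace ℝ (Fin n),
      ‖x‖ = 1 ∧ ‖y‖ = 1 ∧ inner ℝ x y = 0 ∧ scriptL d P x y < r := by
  have : Nonempty (OrthoPair n) :=
    ⟨⟨(EuclideanSpace.single ⟨0, by omega⟩ 1, EuclideanSpace.single ⟨1, by omega⟩ 1),
      by simp, by simp, by simp [EuclideanSpace.inner_single_left]⟩⟩
  obtain ⟨⟨⟨x, y⟩, hx, hy, hxy⟩, hlt⟩ := exists_lt_of_ciInf_lt h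
  exact ⟨x, y, hx, hy, hxy, hlt⟩

theorem norm_evalSystem_le_scriptL : ‖evalSystem P x‖ ≤ scriptL d P x y :=
  Real.le_sqrt_of_sq_le (le_add_of_nonneg_left (sq_nonneg _))

theorem norm_degreeScale_jacobianApply_le_scriptL :
    ‖degreeScale d (jacobianApply P x y)‖ ≤ scriptL d P x y :=
  Real.le_sqrt_of_sq_le (le_add_of_nonneg_right (sq_nonneg _))

theorem norm_le_sqrt_mul_norm_degreeScale (hd : ∀ j, 1 ≤ d j) (hdD : ∀ j, d j ≤ D)
    (v : EuclideanSpace ℝ (Fin m)) : ‖v‖ ≤ √D * ‖degreeScale d v‖ := by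
  rw [← sq_le_sq₀ (norm_nonneg _) (by positivity), mul_pow, Real.sq_sqrt (Nat.cast_nonneg _),
    EuclideanSpace.norm_sq_eq, EuclideanSpace.norm_sq_eq, Finset.mul_sum]
  refine Finset.sum_le_sum fun j _ => ?_
  have hdj : (0 : ℝ) < d j := Nat.cast_pos.2 (hd j)
  have hdjD : (d j : ℝ) ≤ D := Nat.cast_le.2 (hdD j)
  rw [degreeScale, norm_mul, mul_pow, norm_inv, inv_pow, Real.norm_eq_abs √_, sq_abs,
    Real.sq_sqrt hdj.le, ← mul_assoc, ← div_eq_mul_inv]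
  exact le_mul_of_one_le_left (by positivity) ((one_le_div hdj).2 hdjD)

-- Here `16 ^ (k + 2)` is the ratio of the volumes of the balls of radii `8` and `1 / 2`.
theorem four_mul_sqrt_pow_div_sixteen_pow {τ : ℝ} (hτ : 0 ≤ τ) (k : ℕ) :
    (4 * √τ) ^ (2 * k + 1) / 16 ^ (k + 2) = τ ^ (((k + 2 : ℕ) : ℝ) - 3 / 2) / 64 := by
  have sqrt_pow : √τ ^ (2 * k + 1) = τ ^ (((k + 2 : ℕ) : ℝ) - 3 / 2) := by
    rw [Real.sqrt_eq_rpow, ← Real.rpow_mul_natCast hτ]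
    congr 1
    push_cast
    ring
  rw [mul_pow, sqrt_pow, show (16 : ℝ) ^ (k + 2) = 64 * 4 ^ (2 * k + 1) by
    rw [show (16 : ℝ) = 4 ^ 2 by norm_num, ← pow_mul]; ring]
  field_simp

theorem norm_evalSystem_normalize_planarScaling_le_of_scriptL_le (hD : 1 ≤ D)
    (hd : ∀ j, 1 ≤ d j) (hdD : ∀ j, d j ≤ D) (hP : ∀ j, (P j).totalDegree ≤ D) {α γ : ℝ}
    (hα : 0 < α) (hγ : 0 < γ) (hαγ : α ≤ γ * D / 2) (hsup : systemSupNorm P ≤ γ)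
    (hx : ‖x‖ = 1) (hy : ‖y‖ = 1) (hxy : inner ℝ x y = 0) (hL : scriptL d P x y ≤ 2 * α)
    {β : ℝ} (hβ : β = 4 * √(α / (γ * D ^ 2))) {v : EuclideanSpace ℝ (Fin n)}
    (hv : v ∈ ball x (1 / 2)) :
    ‖evalSystem P (normalize (planarScaling x y β (β ^ 2) v))‖ ≤
      (10 + 48 * Real.exp 1) * α := by
  have D_pos : (0 : ℝ) < D := Nat.cast_pos.2 hD
  have β_pos : 0 < β := by rw [hβ]; positivity
  have β_sq : β ^ 2 = 16 * α / (γ * D ^ 2) := by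
    rw [hβ, mul_pow, Real.sq_sqrt (by positivity)]
    ring
  have sqrt_D_mul_β_le : √D * β ≤ 4 := by
    refine (sq_le_sq₀ (by positivity) (by norm_num)).1 ?_
    rw [mul_pow, Real.sq_sqrt D_pos.le, β_sq, mul_div_assoc', div_le_iff₀ (by positivity)]
    nlinarith [mul_le_mul_of_nonneg_left hαγ D_pos.le]
  have norm_jacobian_le : ‖jacobianApply P x y‖ ≤ √D * (2 * α) :=
    (norm_le_sqrt_mul_norm_degreeScale hd hdD _).trans (by
      gcongr
      exact norm_degreeScale_jacobianApply_le_scriptL.trans hL)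
  calc ‖evalSystem P (normalize (planarScaling x y β (β ^ 2) v))‖
      ≤ ‖evalSystem P x‖ + ‖jacobianApply P x y‖ * β +
          3 * D ^ 2 * (Real.exp 1 * systemSupNorm P) * β ^ 2 :=
        norm_evalSystem_normalize_planarScaling_le hD hP hx hy hxy β_pos hv
    _ ≤ 2 * α + √D * (2 * α) * β + 3 * D ^ 2 * (Real.exp 1 * γ) * β ^ 2 := by
        gcongr
        exact norm_evalSystem_le_scriptL.trans hL
    _ = 2 * α + 2 * α * (√D * β) + 48 * Real.exp 1 * α := by
        rw [β_sq]
        field_simp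
        ring
    _ ≤ 2 * α + 2 * α * 4 + 48 * Real.exp 1 * α := by gcongr
    _ = (10 + 48 * Real.exp 1) * α := by ring

theorem le_cond_ball_real_norm_evalSystem_normalize_le (hn : 2 ≤ n) (hD : 1 ≤ D)
    (hd : ∀ j, 1 ≤ d j) (hdD : ∀ j, d j ≤ D) (hP : ∀ j, (P j).totalDegree ≤ D) {α γ : ℝ}
    (hα : 0 < α) (hγ : 0 < γ) (hαγ : α ≤ γ * D / 2) (hL : systemL d P ≤ α)
    (hsup : systemSupNorm P ≤ γ) :
    (α / (γ * D ^ 2)) ^ ((n : ℝ) - 3 / 2) / 64 ≤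
      (volume[|ball (0 : EuclideanSpace ℝ (Fin n)) 8]).real
        {w | ‖evalSystem P (normalize w)‖ ≤ (10 + 48 * Real.exp 1) * α} := by
  obtain ⟨k, rfl⟩ := Nat.exists_eq_add_of_le' hn
  have one_le_D : (1 : ℝ) ≤ D := Nat.one_le_cast.2 hD
  obtain ⟨x, y, hx, hy, hxy, hlt⟩ :=
    exists_scriptL_lt_of_systemL_lt hn (hL.trans_lt (lt_two_mul_self hα))
  set β : ℝ := 4 * √(α / (γ * D ^ 2)) with hβ
  have β_sq_le : β ^ 2 ≤ 8 := by
    rw [hβ, mul_pow, Real.sq_sqrt (by positivity), mul_div_assoc', div_le_iff₀ (by positivity)]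
    nlinarith [mul_le_mul_of_nonneg_left one_le_D (by positivity : 0 ≤ γ * D)]
  rw [← four_mul_sqrt_pow_div_sixteen_pow (by positivity),
    ← cond_ball_real_image_planarScaling finrank_euclideanSpace_fin hx hy hxy
      (by positivity : 0 < β) β_sq_le]
  exact measureReal_mono (Set.image_subset_iff.2 fun v hv =>
    norm_evalSystem_normalize_planarScaling_le_of_scriptL_le hD hd hdD hP hα hγ hαγ hsup
      hx hy hxy hlt.le hβ hv)

end SmallSystemL

section MainEstimate

open MeasureTheory ProbabilityTheory Metric NormedSpace

theorem pow_div_rpow_div_le {n m : ℕ} (hm : 1 ≤ m) {α g K : ℝ} (hα : 0 < α) (hg : 0 < g)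
    (hK : 0 ≤ K) :
    (K * α) ^ m / ((α / g) ^ ((n : ℝ) - 3 / 2) / 64) ≤
      α ^ ((3 / 2 : ℝ) + m - n) * g ^ ((n : ℝ) - 3 / 2) * (64 * K) ^ m := by
  have rpow_α : α ^ ((3 / 2 : ℝ) + m - n) = α ^ m / α ^ ((n : ℝ) - 3 / 2) := by
    rw [← Real.rpow_natCast, ← Real.rpow_sub hα]
    ring_nf
  calc (K * α) ^ m / ((α / g) ^ ((n : ℝ) - 3 / 2) / 64)
      = α ^ ((3 / 2 : ℝ) + m - n) * g ^ ((n : ℝ) - 3 / 2) * (64 * K ^ m) := by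
        rw [Real.div_rpow hα.le hg.le, rpow_α, mul_pow]
        field_simp
    _ ≤ α ^ ((3 / 2 : ℝ) + m - n) * g ^ ((n : ℝ) - 3 / 2) * (64 ^ m * K ^ m) := by
        gcongr
        exact le_self_pow₀ (by norm_num) (by omega)
    _ = _ := by rw [mul_pow]

theorem theorem3p4_general {n m : ℕ} (hn : 2 ≤ n) (hm : 1 ≤ m) {d : Fin m → ℕ}
    (hd : ∀ j, 1 ≤ d j) {D : ℕ} (hdD : ∀ j, d j ≤ D) {Ω : Type*} [MeasurableSpace Ω]
    {μ : Measure Ω} [IsProbabilityMeasure μ]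
    {c : ∀ j, Ω → EuclideanSpace ℝ (ExponentIndex n (d j))} (hc : ∀ j, Measurable (c j))
    (hindep : iIndepFun c μ) {c₀ : ℝ} (hc₀ : 0 ≤ c₀) (hsmall : ∀ j, SmallBall μ (c j) c₀)
    {α γ : ℝ} (hα : 0 < α) (hγ : 0 < γ) (hαγ : α ≤ γ * D / 2) :
    μ.real {ω | systemL d (fun j => weylForm (c j ω)) ≤ α} ≤
      μ.real {ω | γ ≤ systemSupNorm (fun j => weylForm (c j ω))} +
        α ^ ((3 / 2 : ℝ) + m - n) * (γ * D ^ 2) ^ ((n : ℝ) - 3 / 2) *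
          (64 * Real.exp 1 * (10 + 48 * Real.exp 1) * c₀ / √m) ^ m := by
  set C₁ := 10 + 48 * Real.exp 1
  set ν := volume[|ball (0 : EuclideanSpace ℝ (Fin n)) 8]
  set ρ := (α / (γ * D ^ 2)) ^ ((n : ℝ) - 3 / 2) / 64
  set smallPatch := {ω | ρ ≤ ν.real
    {w | ‖evalSystem (fun j => weylForm (c j ω)) (normalize w)‖ ≤ C₁ * α}}
  have one_le_D : 1 ≤ D := (hd ⟨0, hm⟩).trans (hdD _)
  have : (0 : ℝ) < D := Nat.cast_pos.2 one_le_D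
  have : IsProbabilityMeasure ν :=
    cond_isProbabilityMeasure_of_finite (measure_ball_pos _ _ (by norm_num)).ne'
      measure_ball_lt_top.ne
  have : NeZero n := ⟨by omega⟩
  have ae_ne_zero : ∀ᵐ w ∂ν, w ≠ 0 :=
    cond_absolutelyContinuous.ae_le (compl_mem_ae_iff.2 (measure_singleton 0))
  have subset_union : {ω | systemL d (fun j => weylForm (c j ω)) ≤ α} ⊆
      {ω | γ ≤ systemSupNorm (fun j => weylForm (c j ω))} ∪ smallPatch := by
    intro ω hL
    refine (le_or_gt γ _).imp id fun hsup => ?_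
    exact le_cond_ball_real_norm_evalSystem_normalize_le hn one_le_D hd hdD
      (fun j => (totalDegree_weylForm_le _).trans (hdD j)) hα hγ hαγ hL hsup.le
  calc μ.real {ω | systemL d (fun j => weylForm (c j ω)) ≤ α}
      ≤ μ.real {ω | γ ≤ systemSupNorm (fun j => weylForm (c j ω))} + μ.real smallPatch :=
        (measureReal_mono subset_union).trans (measureReal_union_le _ _)
    _ ≤ μ.real {ω | γ ≤ systemSupNorm (fun j => weylForm (c j ω))} +
          (Real.exp 1 * C₁ * c₀ / √m * α) ^ m / ρ := by
        gcongr
        refine (measureReal_le_measureReal_norm_evalSystem_normalize_le hm hc hindep hsmall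
          (by positivity) (by positivity) ae_ne_zero).trans_eq ?_
        ring
    _ ≤ _ := by
        gcongr
        refine (pow_div_rpow_div_le hm hα (by positivity) (by positivity)).trans_eq ?_
        ring

end MainEstimate

theorem mul_min_le_mul_div_two {n D : ℕ} (hn : 2 ≤ n) (hD : 1 ≤ D) {γ : ℝ} (hγ : 0 < γ) :
    γ * min (((D : ℝ) ^ 6)⁻¹) ((D : ℝ) ^ 2 / n) ≤ γ * D / 2 := by
  rw [mul_div_assoc]
  gcongr
  have two_le_n : (2 : ℝ) ≤ n := Nat.ofNat_le_cast.2 hn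
  rcases hD.eq_or_lt with rfl | hD
  · refine (min_le_right _ _).trans ?_
    push_cast
    gcongr
    norm_num
  · have two_le_D : (2 : ℝ) ≤ D := Nat.ofNat_le_cast.2 hD
    calc min (((D : ℝ) ^ 6)⁻¹) ((D : ℝ) ^ 2 / n) ≤ ((D : ℝ) ^ 6)⁻¹ := min_le_left _ _
      _ ≤ 1 := inv_le_one_of_one_le₀ (one_le_pow₀ (by linarith))
      _ ≤ D / 2 := by linarith

theorem theorem3p4 :
    ∃ C : ℝ, 0 < C ∧
      ∀ (n m : ℕ), 2 ≤ n → 1 ≤ m →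
      ∀ (d : Fin m → ℕ), (∀ j, 1 ≤ d j) →
      ∀ (Ω : Type*) [MeasurableSpace Ω] (μ : MeasureTheory.Measure Ω)
        [MeasureTheory.IsProbabilityMeasure μ]
        (c : ∀ j : Fin m, Ω → EuclideanSpace ℝ (ExponentIndex n (d j))),
        (∀ j, Measurable (c j)) →
        ProbabilityTheory.iIndepFun c μ →
      ∀ (c₀ : ℝ), 0 < c₀ → (∀ j, SmallBall μ (c j) c₀) →
      ∀ (D : ℕ), D = Finset.univ.sup d →
      ∀ (α γ : ℝ), 0 < α → 0 < γ →
        α ≤ γ * min (((D : ℝ) ^ 6)⁻¹) ((D : ℝ) ^ 2 / (n : ℝ)) →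
        μ.real {ω | systemL d (fun j => weylForm (c j ω)) ≤ α} ≤
          μ.real {ω | γ ≤ systemSupNorm (fun j => weylForm (c j ω))} +
            α ^ ((3 / 2 : ℝ) + (m : ℝ) - (n : ℝ)) * √(n : ℝ) *
              (γ * (D : ℝ) ^ 2) ^ ((n : ℝ) - 3 / 2) * (C * c₀ / √(m : ℝ)) ^ m := by
  refine ⟨64 * Real.exp 1 * (10 + 48 * Real.exp 1), by positivity, ?_⟩
  rintro n m hn hm d hd Ω _ μ _ c hc hindep c₀ hc₀ hsmall D rfl α γ hα hγ hαγ
  have hdD (j : Fin m) : d j ≤ Finset.univ.sup d := Finset.le_sup (Finset.mem_univ j)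
  have hD : 1 ≤ Finset.univ.sup d := (hd ⟨0, hm⟩).trans (hdD _)
  have one_le_sqrt_n : 1 ≤ √(n : ℝ) := Real.one_le_sqrt.2 (Nat.one_le_cast.2 (by omega))
  refine (theorem3p4_general hn hm hd hdD hc hindep hc₀.le hsmall hα hγ
    (hαγ.trans (mul_min_le_mul_div_two hn hD hγ))).trans ?_
  gcongr
  exact le_mul_of_one_le_right (by positivity) one_le_sqrt_n
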